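/- **Theorem.** For a finite simple graph $\Gamma$ with adjacency matrix $A(\Gamma)$ and diagonal degree matrix $D(\Gamma)$, and $0\le\alpha\le 1$, let $A_\alpha(\Gamma)=\alpha D(\Gamma)+(1-\alpha)A(\Gamma)$; the $A_\alpha$-spectrum of $\Gamma$ is the multiset of eigenvalues of $A_\alpha(\Gamma)$. The power graph $\mathcal P(\mathcal G)$ of a finite group $\mathcal G$ has vertex set $\mathcal G$, with distinct $x,y$ adjacent if and only if $x^i=y$ or $y^i=x$ for some $2\le i\le |\mathcal G|$. Write $\phi$ for Euler's function and $\lambda^{(k)}$ for an eigenvalue $\lambda$ listed $k$ times. Let $p\neq q$ be primes, $N\ge 1$, $n=pq^N$, and let $\mathbb Z_n$ be the cyclic group of order $n$. Let $M_N$ be the following $(2N+1)\times(2N+1)$ matrix. Its rows and columns are indexed by the symbols $c,\ p,\ q^j\ (1\le j\le N),\ pq^j\ (1\le j\le N-1)$, with $n_c=\phi(n)+1$ and $n_d=\phi(d)$ for $d\ne c$. Two distinct symbols are called adjacent if one of them is $c$, or if both are divisors and one divides the other; thus $p\sim pq^j$, $p\not\sim q^j$, $q^i\sim q^j$, $pq^i\sim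 pq^j$, and $q^i\sim pq^j$ exactly when $i\le j$. For $u\ne v$ the $(u,v)$ entry of $M_N$ is $(1-\alpha)n_v$ if $u\sim v$ and $0$ otherwise. The diagonal entries are $$z_c=\phi(n)+\alpha(n-\phi(n)-1),\qquad z_p=\phi(p)-1+\alpha\bigl(\phi(n)+1+\phi(p)(q^{N-1}-1)\bigr),$$ $$z_{q^j}=\phi(q^j)-1+\alpha\bigl(\phi(n)+q^N-\phi(q^j)+\phi(p)(q^{N-1}-q^{j-1})\bigr)\quad(1\le j\le N),$$ $$z_{pq^j}=\phi(pq^j)-1+\alpha\bigl(\phi(n)+\phi(p)+q^j+\phi(p)(q^{N-1}-1-\phi(q^j))\bigr)\quad(1\le j\le N-1).$$ (i) If $N=2m$ is even, the $A_\alpha$-spectrum of $\mathcal P(\mathbb Z_n)$ consists, as a multiset, of - $(\alpha n-1)^{(\phi(n))}$, - $\bigl(\alpha(\phi(n)+\phi(p)q^{2m-1}+1)-1\bigr)^{(\phi(p)-1)}$, - $\bigl(\alpha(\phi(n)+q^{2m}+\phi(p)(q^{2m-1}-q^{j-1}))-1\bigr)^{(\phi(q^j)-1)}$ for $1\le j\le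 2m$, - $\bigl(\alpha(\phi(n)+q^{j}+\phi(p)q^{2m-1})-1\bigr)^{(\phi(pq^j)-1)}$ for $1\le j\le 2m-1$, together with the $4m+1$ zeros, with multiplicity, of the characteristic polynomial of $M_{2m}$. (ii) If $N=2m+1$ is odd, the $A_\alpha$-spectrum of $\mathcal P(\mathbb Z_n)$ consists, as a multiset, of - $(\alpha n-1)^{(\phi(n))}$, - $\bigl(\alpha(\phi(n)+\phi(p)q^{2m}+1)-1\bigr)^{(\phi(p)-1)}$, - $\bigl(\alpha(\phi(n)+q^{2m+1}+\phi(p)(q^{2m}-q^{j-1}))-1\bigr)^{(\phi(q^j)-1)}$ for $1\le j\le 2m+1$, - $\bigl(\alpha(\phi(n)+q^{j}+\phi(p)q^{2m})-1\bigr)^{(\phi(pq^j)-1)}$ for $1\le j\le 2m$, together with the $4m+3$ zeros, with multiplicity, of the characteristic polynomial of $M_{2m+1}$. -/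

import Mathlib

open scoped Nat

/-- The (undirected) power graph of a group `G`: the vertices are the elements of `G`, and two
distinct elements are adjacent iff `x ^ i = y` or `y ^ i = x` for some `2 ≤ i ≤ |G|`. -/
def powerGraph (G : Type*) [Group G] : SimpleGraph G where
  Adj x y := x ≠ y ∧ ∃ i : ℕ, 2 ≤ i ∧ i ≤ Nat.card G ∧ (x ^ i = y ∨ y ^ i = x)
  symm := ⟨fun _ _ h => ⟨h.1.symm, h.2.imp fun _ hi => ⟨hi.1, hi.2.1, hi.2.2.symm⟩⟩⟩
  loopless := ⟨fun _ h => h.1 rfl⟩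

/-- The matrix `A_α(Γ) = α D(Γ) + (1 - α) A(Γ)` of a finite graph. -/
def aAlphaMatrix {V : Type*} [Fintype V] [DecidableEq V] (Γ : SimpleGraph V)
    [DecidableRel Γ.Adj] (α : ℝ) : Matrix V V ℝ :=
  α • Γ.degMatrix ℝ + (1 - α) • Γ.adjMatrix ℝ

/-- The `A_α`-spectrum of a finite graph: the multiset of eigenvalues of `A_α(Γ)`, i.e. of zeros
of its characteristic polynomial with multiplicity. -/
noncomputable def aAlphaSpectrum {V : Type*} [Fintype V] [DecidableEq V] (Γ : SimpleGraph V)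
    [DecidableRel Γ.Adj] (α : ℝ) : Multiset ℝ :=
  (aAlphaMatrix Γ α).charpoly.roots

/-- The matrix is symmetric, so no eigenvalue is lost by working over `ℝ`. -/
theorem card_aAlphaSpectrum {V : Type*} [Fintype V] [DecidableEq V] (Γ : SimpleGraph V)
    [DecidableRel Γ.Adj] (α : ℝ) : (aAlphaSpectrum Γ α).card = Fintype.card V := by
  have h : (aAlphaMatrix Γ α).IsHermitian := by
    ext i j
    simp [aAlphaMatrix, SimpleGraph.degMatrix, Matrix.diagonal_apply, SimpleGraph.adj_comm,
      eq_comm]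
    split_ifs with hij
    · rw [hij]
    · rfl
  rw [aAlphaSpectrum, h.roots_charpoly_eq_eigenvalues]
  simp

/-- The `2N + 1` blocks of vertices of the power graph of a cyclic group of order `p * q ^ N`,
in this order: the identity together with the generators; the elements of order `p`; the elements
of order `q ^ (j + 1)` for `j < N`; the elements of order `p * q ^ (j + 1)` for `j < N - 1`. -/
abbrev Block (N : ℕ) : Type := Unit ⊕ Unit ⊕ Fin N ⊕ Fin (N - 1)

/-- The sizes `n_i` of the blocks. -/
def blockSize (p q N : ℕ) : Block N → ℕ
  | .inl _ => φ (p * q ^ N) + 1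
  | .inr (.inl _) => φ p
  | .inr (.inr (.inl j)) => φ (q ^ (j.val + 1))
  | .inr (.inr (.inr j)) => φ (p * q ^ (j.val + 1))

/-- Adjacency of distinct blocks (only used off the diagonal): the first block is joined to all
others; `p ≁ q ^ i`; `p ∼ p q ^ j`; `q ^ i ∼ q ^ j`; `q ^ i ∼ p q ^ j` iff `i ≤ j`;
`p q ^ i ∼ p q ^ j`. -/
def blockAdj {N : ℕ} : Block N → Block N → Bool
  | .inl _, _ => true
  | _, .inl _ => true
  | .inr (.inl _), .inr (.inl _) => true
  | .inr (.inl _), .inr (.inr (.inl _)) => false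
  | .inr (.inr (.inl _)), .inr (.inl _) => false
  | .inr (.inl _), .inr (.inr (.inr _)) => true
  | .inr (.inr (.inr _)), .inr (.inl _) => true
  | .inr (.inr (.inl _)), .inr (.inr (.inl _)) => true
  | .inr (.inr (.inl i)), .inr (.inr (.inr j)) => decide (i.val ≤ j.val)
  | .inr (.inr (.inr j)), .inr (.inr (.inl i)) => decide (i.val ≤ j.val)
  | .inr (.inr (.inr _)), .inr (.inr (.inr _)) => true

/-- The diagonal entries `z_i` of the quotient matrix. -/
noncomputable def blockDiag (p q N : ℕ) (α : ℝ) : Block N → ℝ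
  | .inl _ =>
      φ (p * q ^ N) + α * (((p * q ^ N : ℕ) : ℝ) - φ (p * q ^ N) - 1)
  | .inr (.inl _) =>
      (φ p : ℝ) - 1 + α * ((φ (p * q ^ N) : ℝ) + 1 + φ p * ((q : ℝ) ^ (N - 1) - 1))
  | .inr (.inr (.inl j)) =>
      (φ (q ^ (j.val + 1)) : ℝ) - 1
        + α * ((φ (p * q ^ N) : ℝ) + (q : ℝ) ^ N - φ (q ^ (j.val + 1))
          + φ p * ((q : ℝ) ^ (N - 1) - (q : ℝ) ^ j.val))
  | .inr (.inr (.inr j)) =>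
      (φ (p * q ^ (j.val + 1)) : ℝ) - 1
        + α * ((φ (p * q ^ N) : ℝ) + φ p + (q : ℝ) ^ (j.val + 1)
          + φ p * ((q : ℝ) ^ (N - 1) - 1 - φ (q ^ (j.val + 1))))

/-- The quotient matrix of order `2N + 1`: diagonal entries `z_i`, and off the diagonal
`(1 - α) n_j` or `0` according as the blocks `i`, `j` are adjacent or not. -/
noncomputable def quotientMatrix (p q N : ℕ) (α : ℝ) : Matrix (Block N) (Block N) ℝ :=
  Matrix.of fun i j =>
    if i = j then blockDiag p q N α i
    else if blockAdj i j then (1 - α) * (blockSize p q N j : ℝ) else 0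

/-!
Two elements of a finite cyclic group are adjacent in the power graph exactly when they are
distinct and the order of one divides the order of the other
(`powerGraph_adj_iff_orderOf_dvd`). Hence the power graph of `ℤ / p q ^ N` is a blow-up of a small
graph on the divisors: the vertices are partitioned into blocks, one per element order, with the
identity joining the generators since both are adjacent to everything. Each block is a clique,
two blocks are completely joined or not joined at all, and the degree depends only on the block.

For such a blow-up along `f : V → B`, the matrix `A_α` is `diag (e ∘ f) + (C (f x) (f y))_{x, y}`
for a vector `e` and a matrix `C` indexed by blocks, that is, `diag (e ∘ f) + P C Pᵀ` with `P` the
incidence matrix of the partition. Since `Pᵀ diag (d ∘ f) P = diag (n_b d_b)`, with `n_b` the block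
sizes, the identity `det (1 - M N) = det (1 - N M)` turns the determinant of
`x - diag (e ∘ f) - P C Pᵀ` into a determinant indexed by blocks. The outcome
(`Matrix.charpoly_diagonal_comp_add_submatrix`) is that the characteristic polynomial is
`∏ (X - e_b) ^ (n_b - 1)` times that of the quotient matrix `diag e + C diag (n_b)`. Here
`e_b = α r_b - 1`, where `r_b` is the size of the closed neighbourhood of a vertex of the block `b`.

It remains to compute `n_b` (Euler's function, as the group is cyclic) and `r_b`
(`sum_blockSize_blockAdj`, from `∑_{i=1}^k φ (q ^ i) = q ^ k - 1`). The argument does not depend on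
the parity of `N`.
-/

/-! ### The characteristic polynomial of a blow-up -/

/-- Reduction of a determinant on `V` to one on `B`: with `P` the incidence matrix of `f`, the
matrix on the left is `diag (d ∘ f) - P C Pᵀ`, and the Weinstein–Aronszajn identity moves `P` to the
other side. -/
theorem Matrix.det_diagonal_comp_sub_submatrix {K V B : Type*} [Field K] [Fintype V]
    [DecidableEq V] [Fintype B] [DecidableEq B] (f : V → B) (C : Matrix B B K) (d : B → K)
    (hd : ∀ b, d b ≠ 0) :
    (∏ b, d b) * (Matrix.diagonal (d ∘ f) - C.submatrix f f).det =
      (∏ v, d (f v)) *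
        (Matrix.diagonal d - C * Matrix.diagonal fun b => (Fintype.card {v // f v = b} : K)).det := by
  let P : Matrix V B K := Matrix.of fun v b => if f v = b then 1 else 0
  have hC : C.submatrix f f = P * C * P.transpose := by
    ext v w
    simp [P, Matrix.mul_apply]
  have hA : Matrix.diagonal (d ∘ f) - C.submatrix f f =
      Matrix.diagonal (d ∘ f) *
        (1 - (Matrix.diagonal fun v => (d (f v))⁻¹) * P * (C * P.transpose)) := by
    rw [Matrix.mul_sub, Matrix.mul_one, hC]
    congr 1
    simp only [← Matrix.mul_assoc, Matrix.diagonal_mul_diagonal, Function.comp_apply]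
    simp [hd]
  have hP : P.transpose * ((Matrix.diagonal fun v => (d (f v))⁻¹) * P) =
      Matrix.diagonal fun b => (Fintype.card {v // f v = b} : K) * (d b)⁻¹ := by
    ext b b'
    rw [Matrix.mul_apply]
    simp only [Matrix.diagonal_mul, Matrix.transpose_apply, Matrix.of_apply, P,
      Matrix.diagonal_apply]
    by_cases h : b = b'
    · subst h
      rw [if_pos rfl, Fintype.card_subtype, ← nsmul_eq_mul, ← Finset.sum_const, Finset.sum_filter]
      refine Finset.sum_congr rfl fun v _ => ?_
      split_ifs with hv <;> simp [hv]
    · rw [if_neg h]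
      refine Finset.sum_eq_zero fun v _ => ?_
      by_cases hv : f v = b
      · simp [hv, h]
      · simp [hv]
  have hQ : Matrix.diagonal d - C * Matrix.diagonal (fun b => (Fintype.card {v // f v = b} : K)) =
      (1 - C * Matrix.diagonal fun b => (Fintype.card {v // f v = b} : K) * (d b)⁻¹) *
        Matrix.diagonal d := by
    rw [Matrix.sub_mul, Matrix.one_mul, Matrix.mul_assoc, Matrix.diagonal_mul_diagonal]
    simp [hd]
  rw [hA, hQ, Matrix.det_mul, Matrix.det_mul, Matrix.det_one_sub_mul_comm, Matrix.mul_assoc C, hP,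
    Matrix.det_diagonal, Matrix.det_diagonal]
  simp only [Function.comp_apply]
  ring

open Polynomial in
/-- Surjectivity of `f` makes every fibre nonempty, so that the truncated exponent is the genuine
fibre size minus one. -/
theorem Matrix.charpoly_diagonal_comp_add_submatrix {K V B : Type*} [Field K] [Infinite K]
    [Fintype V] [DecidableEq V] [Fintype B] [DecidableEq B] (f : V → B)
    (hf : Function.Surjective f) (C : Matrix B B K) (e : B → K) :
    (Matrix.diagonal (e ∘ f) + C.submatrix f f).charpoly =
      (∏ b, (X - Polynomial.C (e b)) ^ (Fintype.card {v // f v = b} - 1)) *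
        (Matrix.diagonal e +
          C * Matrix.diagonal fun b => (Fintype.card {v // f v = b} : K)).charpoly := by
  -- It suffices to compare values off the range of `e`, where `diag (x - e)` is invertible.
  refine Polynomial.eq_of_infinite_eval_eq _ _ ?_
  refine (Set.Finite.infinite_compl (Set.finite_range e)).mono fun x hx => ?_
  have hd : ∀ b, x - e b ≠ 0 := fun b h => hx ⟨b, (sub_eq_zero.1 h).symm⟩
  have key := Matrix.det_diagonal_comp_sub_submatrix f C (fun b => x - e b) hd
  have hprod : ∏ v, (x - e (f v)) =
      (∏ b, (x - e b)) * ∏ b, (x - e b) ^ (Fintype.card {v // f v = b} - 1) := by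
    rw [← Finset.prod_mul_distrib, ← Fintype.prod_fiberwise' f fun b => x - e b]
    refine Finset.prod_congr rfl fun b _ => ?_
    obtain ⟨v, hv⟩ := hf b
    have : 0 < Fintype.card {v // f v = b} := Fintype.card_pos_iff.2 ⟨⟨v, hv⟩⟩
    rw [← pow_succ', Nat.sub_add_cancel this, Finset.prod_const, Finset.card_univ]
  rw [hprod, mul_assoc] at key
  have key := mul_left_cancel₀ (Finset.prod_ne_zero_iff.2 fun b _ => hd b) key
  simp only [Set.mem_ofPred_eq, Polynomial.eval_mul, Polynomial.eval_prod, Polynomial.eval_pow,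
    Polynomial.eval_sub, Polynomial.eval_X, Polynomial.eval_C, Matrix.eval_charpoly]
  convert key using 2
  · rw [← sub_sub]
    congr 1
    ext v w
    simp [Matrix.diagonal_apply, Matrix.scalar_apply]
    split_ifs <;> simp
  · rw [← sub_sub]
    congr 2
    ext v w
    simp [Matrix.diagonal_apply, Matrix.scalar_apply]
    split_ifs <;> simp

open Polynomial in
/-- A graph whose adjacency depends only on the blocks of the vertices, each block being a clique:
`s b` is the size of the block `b`, and `r b` that of the closed neighbourhood of its vertices. -/
theorem charpoly_aAlphaMatrix_of_block {V B : Type*} [Fintype V] [DecidableEq V] [Fintype B]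
    [DecidableEq B] (Γ : SimpleGraph V) [DecidableRel Γ.Adj] (α : ℝ) (f : V → B)
    (hf : Function.Surjective f) (adj : B → B → Bool) (hrefl : ∀ b, adj b b = true)
    (hadj : ∀ x y, Γ.Adj x y ↔ x ≠ y ∧ adj (f x) (f y) = true) (s : B → ℕ)
    (hs : ∀ b, Fintype.card {v // f v = b} = s b) (r : B → ℝ)
    (hr : ∀ b, ∑ b', (if adj b b' then (s b' : ℝ) else 0) = r b) :
    (aAlphaMatrix Γ α).charpoly = (∏ b, (X - Polynomial.C (α * r b - 1)) ^ (s b - 1)) *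
      (Matrix.of fun b b' => if b = b' then α * (r b - s b) + s b - 1
        else if adj b b' then (1 - α) * (s b' : ℝ) else 0).charpoly := by
  have hdeg : ∀ x, (Γ.degree x : ℝ) + 1 = r (f x) := by
    intro x
    have h1 : (Γ.degree x : ℝ) = ∑ y, if Γ.Adj x y then (1 : ℝ) else 0 := by
      rw [← Finset.sum_filter, Finset.sum_const, nsmul_one, ← SimpleGraph.card_neighborFinset_eq_degree,
        SimpleGraph.neighborFinset_eq_filter]
    have h2 : (1 : ℝ) = ∑ y, if x = y then (1 : ℝ) else 0 := by simp
    rw [← hr, h1]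
    -- The summand `1` counts the vertex itself, which completes its neighbourhood to a closed one.
    refine (congrArg (_ + ·) h2).trans ?_
    rw [← Finset.sum_add_distrib]
    have h3 : ∀ b', (if adj (f x) b' then (s b' : ℝ) else 0) =
        ∑ i : {v // f v = b'}, if adj (f x) b' then (1 : ℝ) else 0 := by
      intro b'
      rw [Finset.sum_const, Finset.card_univ, hs]
      simp
    simp_rw [h3]
    rw [Fintype.sum_fiberwise' f fun b' => if adj (f x) b' then (1 : ℝ) else 0]
    refine Finset.sum_congr rfl fun y _ => ?_
    by_cases h : x = y
    · subst h; simp [hrefl]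
    · simp [hadj, h]
  have hA : aAlphaMatrix Γ α = Matrix.diagonal ((fun b => α * r b - 1) ∘ f) +
      (Matrix.of fun b b' => if adj b b' then 1 - α else 0).submatrix f f := by
    ext x y
    by_cases h : x = y
    · subst h
      simp [aAlphaMatrix, SimpleGraph.degMatrix, hrefl, ← hdeg]
      ring
    · simp [aAlphaMatrix, SimpleGraph.degMatrix, h, hadj]
  rw [hA, Matrix.charpoly_diagonal_comp_add_submatrix f hf]
  simp_rw [hs]
  congr 2
  ext b b'
  by_cases h : b = b'
  · subst h
    simp [hrefl]
    ring
  · simp [h]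

/-! ### Blocks as divisors of `p q ^ N` -/

/-- The pair `(a, k)` such that the elements of the block have order `p ^ a * q ^ k`. The first
block gets the exponents of the generators; the identity, which also lies in it, is treated
separately. -/
def blockExponents {N : ℕ} : Block N → ℕ × ℕ
  | .inl _ => (1, N)
  | .inr (.inl _) => (1, 0)
  | .inr (.inr (.inl j)) => (0, j.val + 1)
  | .inr (.inr (.inr j)) => (1, j.val + 1)

theorem blockExponents_injective {N : ℕ} (hN : 0 < N) :
    Function.Injective (blockExponents (N := N)) := by
  rintro (⟨⟩ | ⟨⟩ | i | i) (⟨⟩ | ⟨⟩ | j | j) h <;>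
    (simp only [blockExponents, Prod.ext_iff] at h; simp [Fin.ext_iff] <;> omega)

theorem blockExponents_ne_zero {N : ℕ} (b : Block N) : blockExponents b ≠ (0, 0) := by
  rcases b with ⟨⟩ | ⟨⟩ | i | i <;> simp [blockExponents]

theorem blockExponents_le {N : ℕ} (b : Block N) : blockExponents b ≤ (1, N) := by
  rcases b with ⟨⟩ | ⟨⟩ | i | i <;> simp [blockExponents] <;> omega

theorem exists_blockExponents_eq {N : ℕ} {e : ℕ × ℕ} (h : e ≤ (1, N)) (h0 : e ≠ (0, 0)) :
    ∃ b : Block N, blockExponents b = e := by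
  obtain ⟨a, k⟩ := e
  obtain ⟨ha, hk⟩ : a ≤ 1 ∧ k ≤ N := h
  rcases k with _ | k
  · obtain rfl : a = 1 := by
      have : a ≠ 0 := fun ha => h0 (by rw [ha])
      omega
    exact ⟨.inr (.inl ()), rfl⟩
  · rcases Nat.le_one_iff_eq_zero_or_eq_one.1 ha with rfl | rfl
    · exact ⟨.inr (.inr (.inl ⟨k, hk⟩)), rfl⟩
    · rcases hk.eq_or_lt with rfl | hk
      · exact ⟨.inl (), rfl⟩
      · exact ⟨.inr (.inr (.inr ⟨k, by omega⟩)), rfl⟩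

/-- Adjacency of blocks is comparability of their exponents in the product order, that is,
divisibility of the corresponding orders. -/
theorem blockAdj_iff_blockExponents_le {N : ℕ} (b b' : Block N) :
    blockAdj b b' = true ↔
      blockExponents b ≤ blockExponents b' ∨ blockExponents b' ≤ blockExponents b := by
  rcases b with ⟨⟩ | ⟨⟩ | i | i <;> rcases b' with ⟨⟩ | ⟨⟩ | j | j <;>
    simp [blockAdj, blockExponents, Prod.le_def] <;> omega

theorem Nat.Prime.pow_mul_pow_dvd_iff {p q : ℕ} (hp : p.Prime) (hq : q.Prime) (hpq : p ≠ q)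
    (e e' : ℕ × ℕ) : p ^ e.1 * q ^ e.2 ∣ p ^ e'.1 * q ^ e'.2 ↔ e ≤ e' := by
  have hcop : ∀ a b, Nat.Coprime (p ^ a) (q ^ b) := fun a b =>
    Nat.Coprime.pow a b ((Nat.coprime_primes hp hq).2 hpq)
  constructor
  · intro h
    exact ⟨(Nat.pow_dvd_pow_iff_le_right hp.one_lt).1
        ((hcop _ _).dvd_of_dvd_mul_right (dvd_of_mul_right_dvd h)),
      (Nat.pow_dvd_pow_iff_le_right hq.one_lt).1
        ((hcop _ _).symm.dvd_of_dvd_mul_left (dvd_of_mul_left_dvd h))⟩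
  · exact fun h => mul_dvd_mul (pow_dvd_pow _ h.1) (pow_dvd_pow _ h.2)

/-! ### The power graph of a cyclic group -/

theorem mem_zpowers_of_orderOf_dvd {G : Type*} [Group G] [Finite G] [IsCyclic G] {x y : G}
    (h : orderOf y ∣ orderOf x) : y ∈ Subgroup.zpowers x := by
  classical
  have := Fintype.ofFinite G
  -- A cyclic group has at most `orderOf x` solutions of `z ^ orderOf x = 1`, and the powers of
  -- `x` are already that many.
  have hsub : Finset.univ.filter (· ∈ Subgroup.zpowers x) ⊆
      Finset.univ.filter fun z : G => z ^ orderOf x = 1 := by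
    refine Finset.monotone_filter_right _ fun z _ hz => ?_
    exact orderOf_dvd_iff_pow_eq_one.1 (orderOf_dvd_of_mem_zpowers hz)
  have hcard : (Finset.univ.filter (· ∈ Subgroup.zpowers x)).card = orderOf x := by
    rw [← Fintype.card_subtype, ← Nat.card_zpowers, Nat.card_eq_fintype_card]
  have heq := Finset.eq_of_subset_of_card_le hsub
    ((IsCyclic.card_pow_eq_one_le (orderOf_pos x)).trans hcard.ge)
  have hy : y ∈ Finset.univ.filter fun z : G => z ^ orderOf x = 1 := by
    simpa using orderOf_dvd_iff_pow_eq_one.1 h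
  simpa [← heq] using hy

theorem powerGraph_adj_iff_orderOf_dvd {G : Type*} [Group G] [Finite G] [IsCyclic G] (x y : G) :
    (powerGraph G).Adj x y ↔ x ≠ y ∧ (orderOf x ∣ orderOf y ∨ orderOf y ∣ orderOf x) := by
  have key : ∀ x y : G, x ≠ y →
      ((∃ i : ℕ, 2 ≤ i ∧ i ≤ Nat.card G ∧ x ^ i = y) ↔ orderOf y ∣ orderOf x) := by
    intro x y hxy
    have hcard : 2 ≤ Nat.card G := Finite.one_lt_card_iff_nontrivial.2 ⟨x, y, hxy⟩
    constructor
    · rintro ⟨i, -, -, rfl⟩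
      exact orderOf_pow_dvd i
    · intro h
      have hy : y ∈ Subgroup.zpowers x :=
        mem_zpowers_of_orderOf_dvd h
      obtain ⟨k, rfl : x ^ k = y⟩ := (mem_powers_iff_mem_zpowers).2 hy
      have hk : x ^ (k % Nat.card G) = x ^ k := pow_mod_natCard x k
      have hlt := Nat.mod_lt k (show Nat.card G > 0 by omega)
      -- The exponent has to lie in `[2, |G|]`: residue `0` is replaced by `|G|`, and residue `1`
      -- would give `x = y`.
      rcases lt_or_ge (k % Nat.card G) 2 with hlt2 | hge
      · rcases Nat.le_one_iff_eq_zero_or_eq_one.1 (Nat.lt_succ_iff.1 hlt2) with h0 | h1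
        · refine ⟨Nat.card G, hcard, le_rfl, ?_⟩
          rw [pow_card_eq_one', ← hk, h0, pow_zero]
        · rw [h1, pow_one] at hk
          exact absurd hk hxy
      · exact ⟨_, hge, hlt.le, hk⟩
  constructor
  · rintro ⟨hne, i, h2, hi, h | h⟩
    · exact ⟨hne, .inr ((key x y hne).1 ⟨i, h2, hi, h⟩)⟩
    · exact ⟨hne, .inl ((key y x hne.symm).1 ⟨i, h2, hi, h⟩)⟩
  · rintro ⟨hne, h | h⟩
    · obtain ⟨i, h2, hi, h⟩ := (key y x hne.symm).2 h
      exact ⟨hne, i, h2, hi, .inr h⟩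
    · obtain ⟨i, h2, hi, h⟩ := (key x y hne).2 h
      exact ⟨hne, i, h2, hi, .inl h⟩

/-! ### The blocks of the power graph of a cyclic group of order `p q ^ N` -/

/-- `f` sends each element to its block: the block of its order, or the first block for the
identity. -/
def IsBlockMap (p q : ℕ) {N : ℕ} {Z : Type*} [Group Z] (f : Z → Block N) : Prop :=
  ∀ x, (x = 1 ∧ f x = .inl ()) ∨
    orderOf x = p ^ (blockExponents (f x)).1 * q ^ (blockExponents (f x)).2

theorem exists_isBlockMap {p q N : ℕ} (hp : p.Prime) (hq : q.Prime)
    {Z : Type*} [Group Z] [Fintype Z] (hZ : Fintype.card Z = p * q ^ N) :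
    ∃ f : Z → Block N, IsBlockMap p q f := by
  suffices h : ∀ x : Z, ∃ b : Block N, (x = 1 ∧ b = .inl ()) ∨
      orderOf x = p ^ (blockExponents b).1 * q ^ (blockExponents b).2 from
    Classical.skolem.1 h
  intro x
  obtain ⟨a, b, ha, hb, hab⟩ := (Nat.dvd_mul).1 (hZ ▸ orderOf_dvd_card (x := x))
  obtain ⟨k, hk, rfl⟩ := (Nat.dvd_prime_pow hq).1 hb
  obtain ⟨l, hl, rfl⟩ := (Nat.dvd_prime_pow (m := 1) hp).1 (by simpa using ha)
  by_cases h0 : (l, k) = (0, 0)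
  · obtain ⟨rfl, rfl⟩ := Prod.ext_iff.1 h0
    exact ⟨_, .inl ⟨orderOf_eq_one_iff.1 (by simpa using hab.symm), rfl⟩⟩
  · obtain ⟨b, hb⟩ := exists_blockExponents_eq (N := N) (e := (l, k)) ⟨hl, hk⟩ h0
    exact ⟨b, .inr (by rw [hb, hab])⟩

theorem IsBlockMap.powerGraph_adj_iff {p q N : ℕ} {Z : Type*} [Group Z] [Finite Z] [IsCyclic Z]
    {f : Z → Block N} (hp : p.Prime) (hq : q.Prime) (hpq : p ≠ q)
    (hf : IsBlockMap p q f) (x y : Z) :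
    (powerGraph Z).Adj x y ↔ x ≠ y ∧ blockAdj (f x) (f y) = true := by
  rw [powerGraph_adj_iff_orderOf_dvd]
  refine and_congr_right fun _ => ?_
  rw [blockAdj_iff_blockExponents_le]
  rcases hf x with ⟨rfl, hx⟩ | hx
  · have h := blockExponents_le (f y)
    rw [hx]
    exact iff_of_true (.inl (by simp)) (.inr h)
  · rcases hf y with ⟨rfl, hy⟩ | hy
    · have h := blockExponents_le (f x)
      rw [hy]
      exact iff_of_true (.inr (by simp)) (.inl h)
    · rw [hx, hy, hp.pow_mul_pow_dvd_iff hq hpq, hp.pow_mul_pow_dvd_iff hq hpq]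

theorem IsBlockMap.eq_iff {p q N : ℕ} {Z : Type*} [Group Z] {f : Z → Block N}
    (hp : p.Prime) (hq : q.Prime) (hpq : p ≠ q) (hN : 0 < N)
    (hf : IsBlockMap p q f)
    (x : Z) (b : Block N) :
    f x = b ↔ (x = 1 ∧ b = .inl ()) ∨
      orderOf x = p ^ (blockExponents b).1 * q ^ (blockExponents b).2 := by
  constructor
  · rintro rfl
    exact hf x
  · rintro (⟨rfl, rfl⟩ | hb)
    · rcases hf 1 with h | h
      · exact h.2
      · have := (hp.pow_mul_pow_dvd_iff hq hpq (blockExponents (f 1)) (0, 0)).1 (by simp [← h])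
        exact absurd (le_antisymm this (by simp [Prod.le_def])) (blockExponents_ne_zero _)
    · rcases hf x with ⟨rfl, -⟩ | h
      · have := (hp.pow_mul_pow_dvd_iff hq hpq (blockExponents b) (0, 0)).1 (by simp [← hb])
        exact absurd (le_antisymm this (by simp [Prod.le_def])) (blockExponents_ne_zero _)
      · refine blockExponents_injective hN (le_antisymm ?_ ?_)
        · exact (hp.pow_mul_pow_dvd_iff hq hpq _ _).1 (h ▸ hb ▸ dvd_rfl)
        · exact (hp.pow_mul_pow_dvd_iff hq hpq _ _).1 (h ▸ hb ▸ dvd_rfl)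

theorem IsBlockMap.card_fiber {p q N : ℕ} {Z : Type*} [Group Z] [Fintype Z] [IsCyclic Z]
    {f : Z → Block N} (hp : p.Prime) (hq : q.Prime) (hpq : p ≠ q) (hN : 0 < N)
    (hZ : Fintype.card Z = p * q ^ N)
    (hf : IsBlockMap p q f) (b : Block N) :
    Fintype.card {x // f x = b} = blockSize p q N b := by
  classical
  have hphi : (Finset.univ.filter fun x : Z =>
      orderOf x = p ^ (blockExponents b).1 * q ^ (blockExponents b).2).card =
        φ (p ^ (blockExponents b).1 * q ^ (blockExponents b).2) := by
    refine IsCyclic.card_orderOf_eq_totient ?_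
    rw [hZ]
    simpa using (hp.pow_mul_pow_dvd_iff hq hpq (blockExponents b) (1, N)).2 (blockExponents_le b)
  simp only [Fintype.card_subtype, hf.eq_iff hp hq hpq hN]
  rcases b with ⟨⟩ | b
  · have h1 : (1 : ℕ) ≠ p ^ 1 * q ^ N := by
      have := Nat.mul_le_mul hp.two_le (Nat.one_le_pow N q hq.pos)
      rw [pow_one]
      omega
    rw [Finset.filter_or, Finset.card_union_of_disjoint, hphi]
    · have h2 : (Finset.univ.filter fun x : Z => x = 1).card = 1 := by
        rw [Finset.card_eq_one]
        exact ⟨1, by ext; simp⟩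
      simp [blockSize, blockExponents, add_comm, h2]
    · refine Finset.disjoint_filter.2 ?_
      rintro x - ⟨rfl, -⟩ h
      exact h1 (by simpa [blockExponents] using h)
  · simp only [reduceCtorEq, and_false, false_or]
    rw [hphi]
    rcases b with ⟨⟩ | i | i <;> simp [blockSize, blockExponents]

/-! ### Closed neighbourhoods and the quotient matrix -/

theorem sum_range_totient_prime_pow_succ {q : ℕ} (hq : q.Prime) (k : ℕ) :
    ∑ i ∈ Finset.range k, (φ (q ^ (i + 1)) : ℝ) = (q : ℝ) ^ k - 1 := by
  induction k with
  | zero => simp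
  | succ k ih =>
    rw [Finset.sum_range_succ, ih, Nat.totient_prime_pow_succ hq, Nat.cast_mul, Nat.cast_pow,
      Nat.cast_pred hq.pos]
    ring

/-- The number of vertices in the closed neighbourhood of a vertex of the given block. -/
def blockNeighborCount (p q N : ℕ) : Block N → ℝ
  | .inl _ => ((p * q ^ N : ℕ) : ℝ)
  | .inr (.inl _) => (φ (p * q ^ N) : ℝ) + φ p * (q : ℝ) ^ (N - 1) + 1
  | .inr (.inr (.inl j)) => (φ (p * q ^ N) : ℝ) + (q : ℝ) ^ N
      + φ p * ((q : ℝ) ^ (N - 1) - (q : ℝ) ^ j.val)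
  | .inr (.inr (.inr j)) => (φ (p * q ^ N) : ℝ) + (q : ℝ) ^ (j.val + 1)
      + φ p * (q : ℝ) ^ (N - 1)

theorem sum_blockSize_blockAdj {p q N : ℕ} (hp : p.Prime) (hq : q.Prime) (hpq : p ≠ q)
    (hN : 0 < N) (b : Block N) :
    ∑ b', (if blockAdj b b' then (blockSize p q N b' : ℝ) else 0) =
      blockNeighborCount p q N b := by
  have hmul : ∀ k, (φ (p * q ^ k) : ℝ) = φ p * φ (q ^ k) := fun k => by
    rw [Nat.totient_mul (((Nat.coprime_primes hp hq).2 hpq).pow_right k), Nat.cast_mul]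
  have hsum : ∀ k, ∑ i : Fin k, (φ (q ^ (i.val + 1)) : ℝ) = (q : ℝ) ^ k - 1 := fun k => by
    rw [Fin.sum_univ_eq_sum_range (fun i => (φ (q ^ (i + 1)) : ℝ)) k,
      sum_range_totient_prime_pow_succ hq]
  have hlow : ∀ k j, j < k → ∑ i : Fin k, (if i.val ≤ j then (φ (q ^ (i.val + 1)) : ℝ) else 0) =
      (q : ℝ) ^ (j + 1) - 1 := fun k j hj => by
    rw [Fin.sum_univ_eq_sum_range (fun i => if i ≤ j then (φ (q ^ (i + 1)) : ℝ) else 0) k,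
      ← sum_range_totient_prime_pow_succ hq, ← Finset.sum_filter]
    congr 1
    ext i
    simp only [Finset.mem_filter, Finset.mem_range]
    omega
  have hhigh : ∀ k j, j ≤ k →
      ∑ i : Fin k, (if j ≤ i.val then (φ p * φ (q ^ (i.val + 1)) : ℝ) else 0) =
        φ p * ((q : ℝ) ^ k - (q : ℝ) ^ j) := fun k j hj => by
    rw [Fin.sum_univ_eq_sum_range (fun i => if j ≤ i then (φ p * φ (q ^ (i + 1)) : ℝ) else 0) k,
      ← Finset.sum_filter, ← Finset.mul_sum]
    have h := Finset.sum_Ico_eq_sub (fun i => (φ (q ^ (i + 1)) : ℝ)) hj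
    rw [sum_range_totient_prime_pow_succ hq, sum_range_totient_prime_pow_succ hq,
      sub_sub_sub_cancel_right] at h
    rw [← h]
    congr 2
    ext i
    simp only [Finset.mem_filter, Finset.mem_range, Finset.mem_Ico]
    omega
  obtain ⟨M, rfl⟩ : ∃ M, N = M + 1 := ⟨N - 1, by omega⟩
  rcases b with ⟨⟩ | ⟨⟩ | j | j
  · simp only [Fintype.sum_sum_type, blockAdj, blockSize, blockNeighborCount, hmul, if_true,
      ← Finset.mul_sum, hsum, Finset.univ_unique, Finset.sum_singleton, Nat.add_sub_cancel]
    push_cast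
    rw [hmul, Nat.totient_prime_pow_succ hq, Nat.totient_prime hp]
    push_cast [hq.one_le, hp.one_le]
    ring
  · simp only [Fintype.sum_sum_type, blockAdj, blockSize, blockNeighborCount, hmul, if_true,
      ← Finset.mul_sum, hsum, Finset.univ_unique, Finset.sum_singleton, Nat.add_sub_cancel,
      Nat.cast_add, Nat.cast_one, Bool.false_eq_true, if_false, Finset.sum_const_zero]
    ring
  · simp only [Fintype.sum_sum_type, blockAdj, blockSize, blockNeighborCount, hmul, if_true,
      hsum, Finset.univ_unique, Finset.sum_singleton, Nat.add_sub_cancel, decide_eq_true_eq,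
      Nat.cast_add, Nat.cast_one, Bool.false_eq_true, if_false, hhigh (M + 1 - 1) j (by omega)]
    ring
  · simp only [Fintype.sum_sum_type, blockAdj, blockSize, blockNeighborCount, hmul, if_true,
      hsum, Finset.univ_unique, Finset.sum_singleton, Nat.add_sub_cancel, decide_eq_true_eq,
      Nat.cast_add, Nat.cast_one, ← Finset.mul_sum, hlow (M + 1) j (by omega)]
    ring

/-- The quotient matrix in the form in which it arises from a blow-up; only the diagonal entries have
to be compared. -/
theorem quotientMatrix_eq {p q N : ℕ} (hp : p.Prime) (hq : q.Prime) (hpq : p ≠ q) (α : ℝ) :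
    quotientMatrix p q N α = Matrix.of fun b b' =>
      if b = b' then α * (blockNeighborCount p q N b - blockSize p q N b) + blockSize p q N b - 1
      else if blockAdj b b' then (1 - α) * (blockSize p q N b' : ℝ) else 0 := by
  have hmul : ∀ k, (φ (p * q ^ k) : ℝ) = φ p * φ (q ^ k) := fun k => by
    rw [Nat.totient_mul (((Nat.coprime_primes hp hq).2 hpq).pow_right k), Nat.cast_mul]
  ext b b'
  simp only [quotientMatrix, Matrix.of_apply]
  refine if_ctx_congr Iff.rfl (fun _ => ?_) fun _ => rfl
  rcases b with ⟨⟩ | ⟨⟩ | j | j <;>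
    simp only [blockDiag, blockNeighborCount, blockSize, hmul, Nat.cast_add, Nat.cast_one] <;>
    ring

/-! ### The spectrum -/

open Polynomial in
theorem roots_prod_X_sub_C_pow_mul {ι K : Type*} [Field K] [Fintype ι] (r : ι → K) (m : ι → ℕ)
    {P : K[X]} (hP : P ≠ 0) :
    ((∏ i, (X - C (r i)) ^ m i) * P).roots = ∑ i, Multiset.replicate (m i) (r i) + P.roots := by
  have h : ∏ i, (X - C (r i)) ^ m i ≠ 0 :=
    Finset.prod_ne_zero_iff.2 fun i _ => pow_ne_zero _ (X_sub_C_ne_zero _)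
  rw [roots_mul (mul_ne_zero h hP), roots_prod _ _ h]
  refine congrArg (· + P.roots) ?_
  change (Multiset.map _ _).sum = (Multiset.map _ _).sum
  congr 2
  funext i
  rw [roots_pow, roots_X_sub_C, Multiset.nsmul_singleton]

theorem sum_fin_succ_eq_sum_Icc {M : Type*} [AddCommMonoid M] (g : ℕ → M) (k : ℕ) :
    ∑ i : Fin k, g (i.val + 1) = ∑ j ∈ Finset.Icc 1 k, g j := by
  rw [Fin.sum_univ_eq_sum_range (fun i => g (i + 1)) k, Finset.range_eq_Ico,
    Finset.sum_Ico_add' g 0 k 1]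
  rfl

/-- The spectrum for every `N ≥ 1`, irrespective of parity. -/
theorem aAlphaSpectrum_powerGraph {p q N : ℕ} (hp : p.Prime) (hq : q.Prime) (hpq : p ≠ q)
    (hN : 0 < N) (α : ℝ) {Z : Type*} [Group Z] [Fintype Z] [DecidableEq Z]
    [DecidableRel (powerGraph Z).Adj] [IsCyclic Z] (hZ : Fintype.card Z = p * q ^ N) :
    aAlphaSpectrum (powerGraph Z) α =
      Multiset.replicate (φ (p * q ^ N)) (α * ((p * q ^ N : ℕ) : ℝ) - 1)
      + Multiset.replicate (φ p - 1)
          (α * ((φ (p * q ^ N) : ℝ) + φ p * (q : ℝ) ^ (N - 1) + 1) - 1)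
      + ∑ j ∈ Finset.Icc 1 N, Multiset.replicate (φ (q ^ j) - 1)
          (α * ((φ (p * q ^ N) : ℝ) + (q : ℝ) ^ N
            + φ p * ((q : ℝ) ^ (N - 1) - (q : ℝ) ^ (j - 1))) - 1)
      + ∑ j ∈ Finset.Icc 1 (N - 1), Multiset.replicate (φ (p * q ^ j) - 1)
          (α * ((φ (p * q ^ N) : ℝ) + (q : ℝ) ^ j + φ p * (q : ℝ) ^ (N - 1)) - 1)
      + (quotientMatrix p q N α).charpoly.roots := by
  obtain ⟨f, hf⟩ := exists_isBlockMap hp hq hZ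
  have hfiber := hf.card_fiber hp hq hpq hN hZ
  have hsurj : Function.Surjective f := fun b => by
    have hpos : 0 < Fintype.card {x // f x = b} := by
      rw [hfiber]
      rcases b with ⟨⟩ | ⟨⟩ | j | j <;>
        simp [blockSize, Nat.totient_pos, hp.pos, hq.pos]
    obtain ⟨x, hx⟩ := Fintype.card_pos_iff.1 hpos
    exact ⟨x, hx⟩
  rw [aAlphaSpectrum, charpoly_aAlphaMatrix_of_block (powerGraph Z) α f hsurj blockAdj
    (fun b => (blockAdj_iff_blockExponents_le b b).2 (.inl le_rfl))
    (hf.powerGraph_adj_iff hp hq hpq) _ hfiber _ (sum_blockSize_blockAdj hp hq hpq hN),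
    ← quotientMatrix_eq hp hq hpq, roots_prod_X_sub_C_pow_mul _ _
      (Matrix.charpoly_monic _).ne_zero]
  simp only [Fintype.sum_sum_type, ← sum_fin_succ_eq_sum_Icc, blockSize, blockNeighborCount,
    Finset.univ_unique, Finset.sum_singleton, Nat.add_sub_cancel, add_assoc]

theorem mainTheorem8 (p q N : ℕ) (hp : p.Prime) (hq : q.Prime) (hpq : p ≠ q) (hN : 0 < N)
    (α : ℝ) (hα0 : 0 ≤ α) (hα1 : α ≤ 1)
    {Z : Type*} [Group Z] [Fintype Z] [DecidableEq Z] [DecidableRel (powerGraph Z).Adj]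
    [IsCyclic Z] (hZ : Fintype.card Z = p * q ^ N) :
    (∀ m : ℕ, N = 2 * m →
      aAlphaSpectrum (powerGraph Z) α =
        Multiset.replicate (φ (p * q ^ (2 * m))) (α * ((p * q ^ (2 * m) : ℕ) : ℝ) - 1)
        + Multiset.replicate (φ p - 1)
            (α * ((φ (p * q ^ (2 * m)) : ℝ) + φ p * (q : ℝ) ^ (2 * m - 1) + 1) - 1)
        + ∑ j ∈ Finset.Icc 1 (2 * m), Multiset.replicate (φ (q ^ j) - 1)
            (α * ((φ (p * q ^ (2 * m)) : ℝ) + (q : ℝ) ^ (2 * m)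
              + φ p * ((q : ℝ) ^ (2 * m - 1) - (q : ℝ) ^ (j - 1))) - 1)
        + ∑ j ∈ Finset.Icc 1 (2 * m - 1), Multiset.replicate (φ (p * q ^ j) - 1)
            (α * ((φ (p * q ^ (2 * m)) : ℝ) + (q : ℝ) ^ j
              + φ p * (q : ℝ) ^ (2 * m - 1)) - 1)
        + (quotientMatrix p q (2 * m) α).charpoly.roots) ∧
    (∀ m : ℕ, N = 2 * m + 1 →
      aAlphaSpectrum (powerGraph Z) α =
        Multiset.replicate (φ (p * q ^ (2 * m + 1))) (α * ((p * q ^ (2 * m + 1) : ℕ) : ℝ) - 1)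
        + Multiset.replicate (φ p - 1)
            (α * ((φ (p * q ^ (2 * m + 1)) : ℝ) + φ p * (q : ℝ) ^ (2 * m) + 1) - 1)
        + ∑ j ∈ Finset.Icc 1 (2 * m + 1), Multiset.replicate (φ (q ^ j) - 1)
            (α * ((φ (p * q ^ (2 * m + 1)) : ℝ) + (q : ℝ) ^ (2 * m + 1)
              + φ p * ((q : ℝ) ^ (2 * m) - (q : ℝ) ^ (j - 1))) - 1)
        + ∑ j ∈ Finset.Icc 1 (2 * m), Multiset.replicate (φ (p * q ^ j) - 1)
            (α * ((φ (p * q ^ (2 * m + 1)) : ℝ) + (q : ℝ) ^ j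
              + φ p * (q : ℝ) ^ (2 * m)) - 1)
        + (quotientMatrix p q (2 * m + 1) α).charpoly.roots) := by
  constructor
  · rintro m rfl
    exact aAlphaSpectrum_powerGraph hp hq hpq hN α hZ
  · rintro m rfl
    exact aAlphaSpectrum_powerGraph hp hq hpq hN α hZ
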